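/- Let $F$ be a free group of finite rank $n\ge 2$ with basis $s_1,\dots,s_n$; words are reduced words in $s_i^{\pm1}$ (elements of $F$) and $|w|$ is word length. For $\varphi:F\to\mathbb R$ put $\delta^1\varphi(g,h)=\varphi(g)+\varphi(h)-\varphi(gh)$ and $D(\varphi)=\sup_{g,h}|\delta^1\varphi(g,h)|$; $\varphi$ is a quasimorphism if $D(\varphi)<\infty$, and then $[\delta^1\varphi]\in H^2_b(F)=H^2_b(F;\mathbb R)$, bounded cohomology being computed by the inhomogeneous (bar) complex of bounded cochains with coboundary $\delta^\bullet$ and cup product $(f\smile f')(g_1,\dots,g_{p+q})=f(g_1,\dots,g_p)f'(g_{p+1},\dots,g_{p+q})$. For a word $w$ let $H_w(g)$ (big Brooks quasimorphism) be the number of occurrences of $w$ as a subword of $g$ minus the number of occurrences of $w^{-1}$, and let $h_w(g)$ be the maximal number of disjoint occurrences of $w$ in $g$ minus that of $w^{-1}$. Two words overlap if one is a proper subword of the other, or if one of them is $xy$ and the other $yz$ as reduced products with $x,y,z\ne 1$. A word is non-self-overlapping if it does not overlap itself; a set of words is independent if no two words in it, equal or not, overlap. Let $\mathcal N$ be the set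 of non-self-overlapping words and $\mathcal N^+\subset\mathcal N$ any subset containing exactly one of $w,w^{-1}$ for each $1\neq w\in\mathcal N$. A function $f$ on a group is alternating if $f(g^{-1})=-f(g)$. For $\alpha:F\to\mathbb R$ alternating and supported on $\mathcal N$ let $\varphi_\alpha=\sum_{w\in\mathcal N^+}\alpha_w h_w$. Write $\varphi_\alpha\in\ell^1_{Ind}$ if $\alpha=\sum_{i\ge1}\alpha_i$ pointwise with $\sum_i\|\alpha_i\|_\infty<\infty$, where each $\alpha_i$ is bounded, alternating, and supported on an independent set closed under inversion; $SInd_\alpha$ is the infimum of $\sum_i\|\alpha_i\|_\infty$ over all such decompositions. For $\lambda=(\lambda_1,\dots,\lambda_n)$ with $\lambda_i:\mathbb Z\to\mathbb R$ bounded and alternating, the Rolli quasimorphism $\phi_\lambda$ maps $s_{i_1}^{m_1}\cdots s_{i_k}^{m_k}$ (with $i_j\ne i_{j+1}$, $m_j\neq0$) to $\sum_j\lambda_{i_j}(m_j)$; put $\|\lambda\|_\infty=\max_i\|\lambda_i\|_\infty$. **Theorem.** There is a universal constant $C$ (independent of $n$ and of all other data) such that the following holds. Let $\beta:F\to\mathbb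 R$ be such that $$S:=\sum_{w\in F}|w|\,|\beta_w|\,D(H_w)<\infty,$$ and let $\psi:=\sum_{w\in F}\beta_w H_w$ (the words may be self-overlapping; the sum is finite at each element of $F$). Then $\psi$ is a quasimorphism, and: 1. For every $\varphi_\alpha\in\ell^1_{Ind}$, $\varphi_\alpha$ is a quasimorphism and $[\delta^1\varphi_\alpha]\smile[\delta^1\psi]=0\in H^4_b(F)$; moreover there is a bounded $\pi:F^3\to\mathbb R$ with $\delta^3\pi=\delta^1\varphi_\alpha\smile\delta^1\psi$ and $\|\pi\|_\infty\le C\cdot SInd_\alpha\cdot S$. 2. For every Rolli quasimorphism $\phi_\lambda$, $\phi_\lambda$ is a quasimorphism and $[\delta^1\phi_\lambda]\smile[\delta^1\psi]=0\in H^4_b(F)$; moreover there is a bounded $\pi:F^3\to\mathbb R$ with $\delta^3\pi=\delta^1\phi_\lambda\smile\delta^1\psi$ and $\|\pi\|_\infty\le C\cdot\|\lambda\|_\infty\cdot S$. -/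

import Mathlib

open scoped NNReal ENNReal

/-! ## Bounded cohomology with trivial real coefficients (bar resolution) -/

section BoundedCohomology

variable (G : Type*) [Group G]

/-- Inhomogeneous real `n`-cochains of `G` (not necessarily bounded). -/
abbrev Cochain (n : ℕ) : Type _ := (Fin n → G) → ℝ

variable {G}

/-- The supremum norm of a real function, with value `∞` if the function is unbounded. -/
noncomputable def supNorm {X : Type*} (f : X → ℝ) : ℝ≥0∞ := ⨆ x, ‖f x‖ₑ

/-- The coboundary map of the bar resolution:
`δⁿ f (g₁, …, gₙ₊₁) = f (g₂, …, gₙ₊₁) + ∑ᵢ (-1)ⁱ f (g₁, …, gᵢ gᵢ₊₁, …, gₙ₊₁) + (-1)ⁿ⁺¹ f (g₁, …, gₙ)`.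
For `j : Fin (n + 1)` (starting at `0`) the tuple `Fin.contractNth j (· * ·) g` multiplies the
neighbouring entries number `j` and `j + 1`, and drops the last entry when `j = n`. -/
noncomputable def delta (n : ℕ) : Cochain G n →ₗ[ℝ] Cochain G (n + 1) where
  toFun f g := f (fun i => g i.succ) +
    ∑ j : Fin (n + 1), (-1 : ℝ) ^ ((j : ℕ) + 1) * f (Fin.contractNth j (· * ·) g)
  map_add' f f' := by
    funext g
    simp only [Pi.add_apply, mul_add, Finset.sum_add_distrib]
    ring
  map_smul' c f := by
    funext g
    simp only [Pi.smul_apply, smul_eq_mul, RingHom.id_apply, mul_add, Finset.mul_sum]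
    congr 1
    exact Finset.sum_congr rfl fun j _ => by ring

/-- The cup product of cochains. -/
def cupCochain {n m : ℕ} (f : Cochain G n) (f' : Cochain G m) : Cochain G (n + m) :=
  fun g => f (fun i => g (Fin.castAdd m i)) * f' (fun j => g (Fin.natAdd n j))

variable (G)

/-- Bounded cochains. -/
def boundedCochains (n : ℕ) : Submodule ℝ (Cochain G n) where
  carrier := {f | ∃ K : ℝ, ∀ g, |f g| ≤ K}
  zero_mem' := ⟨0, fun _ => by simp⟩
  add_mem' := by
    rintro f f' ⟨K, hK⟩ ⟨K', hK'⟩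
    exact ⟨K + K', fun g => (abs_add_le _ _).trans (add_le_add (hK g) (hK' g))⟩
  smul_mem' := by
    rintro c f ⟨K, hK⟩
    refine ⟨|c| * K, fun g => ?_⟩
    rw [Pi.smul_apply, smul_eq_mul, abs_mul]
    exact mul_le_mul_of_nonneg_left (hK g) (abs_nonneg c)

/-- Bounded cocycles `Zⁿ_b(G)`. -/
noncomputable def boundedCocycles (n : ℕ) : Submodule ℝ (Cochain G n) :=
  boundedCochains G n ⊓ LinearMap.ker (delta n)

/-- Bounded coboundaries `Bⁿ_b(G)`: the coboundaries of *bounded* cochains. -/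
noncomputable def boundedCoboundaries : (n : ℕ) → Submodule ℝ (Cochain G n)
  | 0 => ⊥
  | n + 1 => (boundedCochains G n).map (delta n)

/-- Bounded cohomology `Hⁿ_b(G) = Zⁿ_b(G) / Bⁿ_b(G)`. -/
abbrev BoundedCohomology (n : ℕ) : Type _ :=
  boundedCocycles G n ⧸ (boundedCoboundaries G n).submoduleOf (boundedCocycles G n)

variable {G}

theorem cupCochain_bounded {n m : ℕ} {f : Cochain G n} {f' : Cochain G m}
    (hf : f ∈ boundedCochains G n) (hf' : f' ∈ boundedCochains G m) :
    cupCochain f f' ∈ boundedCochains G (n + m) := by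
  obtain ⟨K, hK⟩ := hf
  obtain ⟨K', hK'⟩ := hf'
  refine ⟨K * K', fun g => ?_⟩
  rw [cupCochain, abs_mul]
  exact mul_le_mul (hK _) (hK' _) (abs_nonneg _)
    ((abs_nonneg _).trans (hK (fun i => g (Fin.castAdd m i))))

/-- The Leibniz rule for the coboundary of a cup product, evaluated at a tuple. -/
theorem delta_cupCochain {n m : ℕ} (f : Cochain G n) (f' : Cochain G m)
    (g : Fin (n + m + 1) → G) :
    delta (n + m) (cupCochain f f') g =
      delta n f (fun i : Fin (n + 1) => g ⟨i, by omega⟩) *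
          f' (fun j : Fin m => g ⟨n + 1 + j, by omega⟩) +
        (-1 : ℝ) ^ n * (f (fun i : Fin n => g ⟨i, by omega⟩) *
          delta m f' (fun j : Fin (m + 1) => g ⟨n + j, by omega⟩)) := by
  have hA : ∀ i : Fin n, cupCochain f f'
      (Fin.contractNth (Fin.castAdd (m + 1) i : Fin (n + m + 1)) (· * ·) g) =
      f (Fin.contractNth i.castSucc (· * ·) (fun i : Fin (n + 1) => g ⟨i, by omega⟩)) *
        f' (fun j : Fin m => g ⟨n + 1 + j, by omega⟩) := by
    intro i
    unfold cupCochain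
    congr 2
    funext k
    have h1 : ¬ (n + (k : ℕ) < i) := by omega
    have h2 : ¬ (n + (k : ℕ) = i) := by omega
    change (if n + (k : ℕ) < i then _ else if n + (k : ℕ) = i then _ else
      g (Fin.natAdd n k).succ) = _
    rw [if_neg h1, if_neg h2]
    exact congrArg g (Fin.ext (by simp; omega))
  have hB : ∀ i : Fin (m + 1), cupCochain f f'
      (Fin.contractNth (Fin.natAdd n i : Fin (n + m + 1)) (· * ·) g) =
      f (fun i : Fin n => g ⟨i, by omega⟩) *
        f' (Fin.contractNth i (· * ·) (fun j : Fin (m + 1) => g ⟨n + j, by omega⟩)) := by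
    intro i
    unfold cupCochain
    congr 2
    · funext k
      have h1 : (k : ℕ) < n + i := by omega
      simp only [Fin.contractNth, Fin.val_natAdd, Fin.val_castAdd, h1, if_true]
      rfl
    · funext k
      simp only [Fin.contractNth, Fin.val_natAdd, add_lt_add_iff_left, add_right_inj]
      rfl
  have h0 : cupCochain f f' (fun i => g i.succ) =
      f (fun i : Fin n => g ⟨i + 1, by omega⟩) * f' (fun j : Fin m => g ⟨n + 1 + j, by omega⟩) := by
    unfold cupCochain
    congr 2
    funext k
    exact congrArg g (Fin.ext (by simp; omega))
  have hl : f (Fin.contractNth (Fin.last n) (· * ·) (fun i : Fin (n + 1) => g ⟨i, by omega⟩)) =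
      f (fun i : Fin n => g ⟨i, by omega⟩) := by
    congr 1
    funext k
    have h1 : (k : ℕ) < n := k.2
    simp [Fin.contractNth, h1]
  have hs : ∑ j : Fin (n + m + 1), (-1 : ℝ) ^ ((j : ℕ) + 1) *
        cupCochain f f' (Fin.contractNth j (· * ·) g) =
      ∑ i : Fin n, (-1 : ℝ) ^ ((i : ℕ) + 1) * cupCochain f f'
          (Fin.contractNth (Fin.castAdd (m + 1) i : Fin (n + m + 1)) (· * ·) g) +
      ∑ i : Fin (m + 1), (-1 : ℝ) ^ (n + (i : ℕ) + 1) * cupCochain f f'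
          (Fin.contractNth (Fin.natAdd n i : Fin (n + m + 1)) (· * ·) g) :=
    Fin.sum_univ_add (a := n) (b := m + 1) (fun j : Fin (n + (m + 1)) =>
      (-1 : ℝ) ^ ((j : ℕ) + 1) * cupCochain f f' (Fin.contractNth (n := n + m) j (· * ·) g))
  have e1 : delta (n + m) (cupCochain f f') g = cupCochain f f' (fun i => g i.succ) +
    ∑ j : Fin (n + m + 1), (-1 : ℝ) ^ ((j : ℕ) + 1) *
      cupCochain f f' (Fin.contractNth j (· * ·) g) := rfl
  have e2 : delta n f (fun i : Fin (n + 1) => g ⟨i, by omega⟩) =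
      f (fun i : Fin n => g ⟨i + 1, by omega⟩) +
      (∑ j : Fin n, (-1 : ℝ) ^ ((j : ℕ) + 1) *
        f (Fin.contractNth j.castSucc (· * ·) (fun i : Fin (n + 1) => g ⟨i, by omega⟩)) +
        (-1 : ℝ) ^ (n + 1) * f (fun i : Fin n => g ⟨i, by omega⟩)) := by
    rw [← hl]
    exact congrArg _ (Fin.sum_univ_castSucc _)
  have e3 : delta m f' (fun j : Fin (m + 1) => g ⟨n + j, by omega⟩) =
      f' (fun j : Fin m => g ⟨n + 1 + j, by omega⟩) +
      ∑ j : Fin (m + 1), (-1 : ℝ) ^ ((j : ℕ) + 1) *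
        f' (Fin.contractNth j (· * ·) (fun j : Fin (m + 1) => g ⟨n + j, by omega⟩)) := by
    have : (fun j : Fin m => g ⟨n + 1 + j, by omega⟩) =
        (fun j : Fin m => g ⟨n + (j + 1), by omega⟩) := by
      funext j
      congr 2
      omega
    rw [this]
    rfl
  rw [e1, e2, e3, hs, h0]
  simp only [hA, hB, add_mul, mul_add, Finset.sum_mul,
    Finset.mul_sum, pow_add, pow_one]
  have t1 : ∀ x y z : ℝ, x * (y * z) = x * y * z := fun x y z => (mul_assoc x y z).symm
  simp only [t1]
  have t2 : ∀ i : Fin (m + 1), (-1 : ℝ) ^ n * f (fun i : Fin n => g ⟨i, by omega⟩) *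
      (-1 : ℝ) ^ (i : ℕ) = (-1 : ℝ) ^ n * (-1 : ℝ) ^ (i : ℕ) *
        f (fun i : Fin n => g ⟨i, by omega⟩) := fun i => by ring
  simp only [t2]
  have t3 : ∀ i : Fin (m + 1), (-1 : ℝ) ^ n * (-1 : ℝ) ^ (i : ℕ) *
      f (fun i : Fin n => g ⟨i, by omega⟩) * (-1) = (-1 : ℝ) ^ n * (-1 : ℝ) ^ (i : ℕ) * (-1) *
        f (fun i : Fin n => g ⟨i, by omega⟩) := fun i => by ring
  simp only [t3]
  ring

theorem cupCochain_cocycle {n m : ℕ} {f : Cochain G n} {f' : Cochain G m}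
    (hf : f ∈ boundedCocycles G n) (hf' : f' ∈ boundedCocycles G m) :
    cupCochain f f' ∈ boundedCocycles G (n + m) := by
  refine ⟨cupCochain_bounded hf.1 hf'.1, LinearMap.mem_ker.mpr ?_⟩
  funext g
  rw [delta_cupCochain, LinearMap.mem_ker.mp hf.2, LinearMap.mem_ker.mp hf'.2]
  simp

theorem mem_boundedCoboundaries {n k : ℕ} (h : k + 1 = n) {f : Cochain G n} {u : Cochain G k}
    (hu : u ∈ boundedCochains G k) (hf : ∀ g : Fin (k + 1) → G,
      delta k u g = f (fun i => g (Fin.cast h.symm i))) :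
    f ∈ boundedCoboundaries G n := by
  subst h
  exact ⟨u, hu, funext hf⟩

theorem cupCochain_coboundary_left {n m : ℕ} {f : Cochain G n} {f' : Cochain G m}
    (hf : f ∈ boundedCoboundaries G n) (hf' : f' ∈ boundedCocycles G m) :
    cupCochain f f' ∈ boundedCoboundaries G (n + m) := by
  cases n with
  | zero =>
    have hf0 : f = 0 := hf
    have : cupCochain f f' = 0 := by
      funext g
      simp [cupCochain, hf0]
    rw [this]
    exact zero_mem _
  | succ k =>
    obtain ⟨u, hu, rfl⟩ := hf
    refine mem_boundedCoboundaries (u := cupCochain u f') (by omega)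
      (cupCochain_bounded hu hf'.1) fun g => ?_
    rw [delta_cupCochain, LinearMap.mem_ker.mp hf'.2]
    simp only [Pi.zero_apply, mul_zero, add_zero]
    rfl

theorem cupCochain_coboundary_right {n m : ℕ} {f : Cochain G n} {f' : Cochain G m}
    (hf : f ∈ boundedCocycles G n) (hf' : f' ∈ boundedCoboundaries G m) :
    cupCochain f f' ∈ boundedCoboundaries G (n + m) := by
  cases m with
  | zero =>
    have hf0 : f' = 0 := hf'
    have : cupCochain f f' = 0 := by
      funext g
      simp [cupCochain, hf0]
    rw [this]
    exact zero_mem _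
  | succ k =>
    obtain ⟨u, hu, rfl⟩ := hf'
    refine ⟨(-1 : ℝ) ^ n • cupCochain f u,
      Submodule.smul_mem _ _ (cupCochain_bounded hf.1 hu), ?_⟩
    funext g
    rw [map_smul, Pi.smul_apply]
    erw [delta_cupCochain]
    rw [LinearMap.mem_ker.mp hf.2, smul_eq_mul, Pi.zero_apply, zero_mul, zero_add, ← mul_assoc,
      ← mul_pow]
    simp only [mul_neg, mul_one, neg_neg, one_pow, one_mul]
    rfl

/-- The cup product in bounded cohomology, `[f] ⌣ [f'] = [f ⌣ f']`. -/
noncomputable def cupProduct {n m : ℕ} (a : BoundedCohomology G n) (b : BoundedCohomology G m) :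
    BoundedCohomology G (n + m) :=
  Quotient.map₂ (fun (f : boundedCocycles G n) (f' : boundedCocycles G m) =>
      (⟨cupCochain f.1 f'.1, cupCochain_cocycle f.2 f'.2⟩ : boundedCocycles G (n + m)))
    (by
      intro f₁ f₂ h f'₁ f'₂ h'
      have h1 : f₁.1 - f₂.1 ∈ boundedCoboundaries G n :=
        (Submodule.quotientRel_def ((boundedCoboundaries G n).submoduleOf (boundedCocycles G n))).mp h
      have h2 : f'₁.1 - f'₂.1 ∈ boundedCoboundaries G m :=
        (Submodule.quotientRel_def ((boundedCoboundaries G m).submoduleOf (boundedCocycles G m))).mp h'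
      refine (Submodule.quotientRel_def _).mpr ?_
      have e : cupCochain f₁.1 f'₁.1 - cupCochain f₂.1 f'₂.1 =
          cupCochain (f₁.1 - f₂.1) f'₁.1 + cupCochain f₂.1 (f'₁.1 - f'₂.1) := by
        funext g
        simp only [cupCochain, Pi.sub_apply, Pi.add_apply]
        ring
      change cupCochain f₁.1 f'₁.1 - cupCochain f₂.1 f'₂.1 ∈ boundedCoboundaries G (n + m)
      rw [e]
      exact add_mem (cupCochain_coboundary_left h1 f'₁.2) (cupCochain_coboundary_right f₂.2 h2))
    a b

/-! ### Quasimorphisms -/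

/-- The defect `D(φ) = sup |φ(g) + φ(h) - φ(gh)|`, possibly infinite. -/
noncomputable def defect (φ : G → ℝ) : ℝ≥0∞ := ⨆ g, ⨆ h, ‖φ g + φ h - φ (g * h)‖ₑ

/-- `φ` is a quasimorphism if its defect is finite. -/
def IsQuasimorphism (φ : G → ℝ) : Prop := defect φ < ∞

/-- `δ¹φ`, a function of pairs: `δ¹φ(g, h) = φ(h) - φ(gh) + φ(g)`. -/
noncomputable def deltaOne (φ : G → ℝ) : Cochain G 2 := delta 1 (fun x => φ (x 0))

theorem deltaOne_apply (φ : G → ℝ) (x : Fin 2 → G) :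
    deltaOne φ x = φ (x 0) + φ (x 1) - φ (x 0 * x 1) := by
  simp only [deltaOne, delta, LinearMap.coe_mk, AddHom.coe_mk]
  simp [Fin.contractNth]
  ring

theorem IsQuasimorphism.deltaOne_mem {φ : G → ℝ} (h : IsQuasimorphism φ) :
    deltaOne φ ∈ boundedCocycles G 2 := by
  refine ⟨⟨(defect φ).toReal, fun x => ?_⟩, LinearMap.mem_ker.mpr ?_⟩
  · rw [deltaOne_apply]
    have h1 : ‖φ (x 0) + φ (x 1) - φ (x 0 * x 1)‖ₑ ≤ defect φ :=
      le_iSup₂ (f := fun g h => ‖φ g + φ h - φ (g * h)‖ₑ) (x 0) (x 1)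
    have h2 := ENNReal.toReal_mono h.ne h1
    simpa using h2
  · funext x
    have h3 : ∀ u : Cochain G 2, delta 2 u x = u (fun i => x i.succ) +
        ((-1) * u (Fin.contractNth 0 (· * ·) x) + u (Fin.contractNth 1 (· * ·) x) +
          (-1) * u (Fin.contractNth 2 (· * ·) x)) := by
      intro u
      refine congrArg (u (fun i => x i.succ) + ·) ((Fin.sum_univ_three _).trans ?_)
      norm_num
    rw [h3]
    simp only [deltaOne_apply]
    simp [Fin.contractNth, mul_assoc]
    ring

/-- The class `[δ¹φ] ∈ H²_b(G)` of a quasimorphism `φ`. -/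
noncomputable def qmClass (φ : G → ℝ) (h : IsQuasimorphism φ) : BoundedCohomology G 2 :=
  Submodule.Quotient.mk ⟨deltaOne φ, h.deltaOne_mem⟩

end BoundedCohomology

/-! ## Words in the free group with its standard basis -/

section Words

variable {ι : Type*} [DecidableEq ι]

/-- `w'` is a subword of `w`: `w = u w' v` as a reduced product. -/
def IsSubword (w' w : FreeGroup ι) : Prop :=
  ∃ u v : FreeGroup ι, w = u * w' * v ∧ w.norm = u.norm + w'.norm + v.norm

/-- `w₁ = xy` and `w₂ = yz` as reduced products with `x, y, z` non-empty. -/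
def SuffixPrefixOverlap (w₁ w₂ : FreeGroup ι) : Prop :=
  ∃ x y z : FreeGroup ι, x ≠ 1 ∧ y ≠ 1 ∧ z ≠ 1 ∧
    w₁ = x * y ∧ w₁.norm = x.norm + y.norm ∧ w₂ = y * z ∧ w₂.norm = y.norm + z.norm

/-- Two words overlap properly. -/
def OverlapProperly (w₁ w₂ : FreeGroup ι) : Prop :=
  SuffixPrefixOverlap w₁ w₂ ∨ SuffixPrefixOverlap w₂ w₁

/-- Two words overlap: they overlap properly, or one is a proper subword of the other. -/
def Overlap (w₁ w₂ : FreeGroup ι) : Prop :=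
  OverlapProperly w₁ w₂ ∨ (w₁ ≠ w₂ ∧ (IsSubword w₁ w₂ ∨ IsSubword w₂ w₁))

/-- The set of non-self-overlapping words. -/
def nonSelfOverlapping (ι : Type*) [DecidableEq ι] : Set (FreeGroup ι) := {w | ¬ Overlap w w}

/-- A family of words is independent if no two words in it (equal or not) overlap; in particular
every word in it is non-self-overlapping. -/
def IsIndependent (I : Set (FreeGroup ι)) : Prop := ∀ w₁ ∈ I, ∀ w₂ ∈ I, ¬ Overlap w₁ w₂

/-- A set of group elements is symmetric if it is closed under inversion. -/
def IsSymmetricSet {G : Type*} [Group G] (W : Set G) : Prop := ∀ g ∈ W, g⁻¹ ∈ W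

/-- `P` is a choice of `W⁺`: a subset of `W` containing exactly one of `g, g⁻¹` for every
`g ≠ 1` in `W`. -/
def IsPositiveHalf {G : Type*} [Group G] (W P : Set G) : Prop :=
  P ⊆ W ∧ ∀ g ∈ W, g ≠ 1 → Xor (g ∈ P) (g⁻¹ ∈ P)

/-- A real function on a group is alternating if `f(g⁻¹) = -f(g)`. -/
def IsAlternating {G : Type*} [Group G] (f : G → ℝ) : Prop := ∀ g, f g⁻¹ = - f g

/-! ### Brooks quasimorphisms -/

/-- The positions at which `w` occurs as a subword of `g`. -/
def occurrences (w g : FreeGroup ι) : Finset ℕ :=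
  (Finset.range (g.norm + 1)).filter fun i => w.toWord <+: g.toWord.drop i

/-- The big counting function `C_w`. -/
def bigCount (w g : FreeGroup ι) : ℕ := (occurrences w g).card

/-- The small counting function `c_w`: the maximal number of disjoint occurrences. -/
def smallCount (w g : FreeGroup ι) : ℕ :=
  ((occurrences w g).powerset.filter fun T => ∀ i ∈ T, ∀ j ∈ T, i < j → i + w.norm ≤ j).sup
    Finset.card

/-- The big Brooks quasimorphism `H_w`. -/
def bigBrooks (w g : FreeGroup ι) : ℝ := (bigCount w g : ℝ) - (bigCount w⁻¹ g : ℝ)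

/-- The small Brooks quasimorphism `h_w`. -/
def smallBrooks (w g : FreeGroup ι) : ℝ := (smallCount w g : ℝ) - (smallCount w⁻¹ g : ℝ)

theorem finite_setOf_occurrences (g : FreeGroup ι) :
    {w : FreeGroup ι | (occurrences w g).Nonempty ∨ (occurrences w⁻¹ g).Nonempty}.Finite := by
  have h : {w : FreeGroup ι | (occurrences w g).Nonempty}.Finite := by
    refine Set.Finite.of_finite_image (f := FreeGroup.toWord) ?_
      (FreeGroup.toWord_injective.injOn)
    refine (List.finite_toSet g.toWord.sublists).subset ?_
    rintro _ ⟨w, ⟨i, hi⟩, rfl⟩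
    have h1 := (Finset.mem_filter.mp hi).2
    simpa using h1.sublist.trans (List.drop_sublist i g.toWord)
  have h' : {w : FreeGroup ι | (occurrences w⁻¹ g).Nonempty}.Finite :=
    Set.Finite.preimage (f := fun w : FreeGroup ι => w⁻¹) inv_injective.injOn h
  exact h.union h'

/-- For every `g` only finitely many words `w` satisfy `H_w(g) ≠ 0`. -/
theorem finite_bigBrooks_ne_zero (g : FreeGroup ι) :
    {w : FreeGroup ι | bigBrooks w g ≠ 0}.Finite := by
  refine (finite_setOf_occurrences g).subset fun w hw => ?_
  by_contra hc
  simp only [Set.mem_ofPred_eq, not_or, Finset.not_nonempty_iff_eq_empty] at hc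
  exact hw (by simp [bigBrooks, bigCount, hc.1, hc.2])

/-- For every `g` only finitely many words `w` satisfy `h_w(g) ≠ 0`. -/
theorem finite_smallBrooks_ne_zero (g : FreeGroup ι) :
    {w : FreeGroup ι | smallBrooks w g ≠ 0}.Finite := by
  refine (finite_setOf_occurrences g).subset fun w hw => ?_
  by_contra hc
  simp only [Set.mem_ofPred_eq, not_or, Finset.not_nonempty_iff_eq_empty] at hc
  have h0 : ∀ v : FreeGroup ι, occurrences v g = ∅ → smallCount v g = 0 := by
    intro v hv
    simp [smallCount, hv, Finset.filter_singleton]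
  exact hw (by simp [smallBrooks, h0 _ hc.1, h0 _ hc.2])

/-- The sum `∑_{w ∈ P} α_w h_w` of small Brooks quasimorphisms; when `P` is a choice of the
positive half of the non-self-overlapping words, this is `φ_α`. At each `g` the sum is finite by
`finite_smallBrooks_ne_zero`. -/
noncomputable def smallBrooksSum (P : Set (FreeGroup ι)) (α : FreeGroup ι → ℝ)
    (g : FreeGroup ι) : ℝ := ∑ᶠ w ∈ P, α w * smallBrooks w g

/-- The sum `∑_w β_w H_w` of big Brooks quasimorphisms over all words. At each `g` the sum is
finite by `finite_bigBrooks_ne_zero`. -/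
noncomputable def bigBrooksSum (β : FreeGroup ι → ℝ) (g : FreeGroup ι) : ℝ :=
  ∑ᶠ w, β w * bigBrooks w g

/-- The weighted sum `∑_w |w| |β_w| D(H_w)`. -/
noncomputable def weightedSum (β : FreeGroup ι → ℝ) : ℝ≥0∞ :=
  ∑' w : FreeGroup ι, (w.norm : ℝ≥0∞) * ‖β w‖ₑ * defect (bigBrooks w)

/-! ### The space `ℓ¹_Ind` -/

/-- `α = ∑ᵢ aᵢ` pointwise with `∑ᵢ ‖aᵢ‖_∞ < ∞`, where every `aᵢ` is alternating and supported on
a symmetric independent family (and bounded, since the sum of norms is finite). -/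
structure IsIndDecomposition (α : FreeGroup ι → ℝ) (a : ℕ → FreeGroup ι → ℝ) : Prop where
  alternating : ∀ i, IsAlternating (a i)
  support : ∀ i, ∃ I : Set (FreeGroup ι), IsSymmetricSet I ∧ IsIndependent I ∧
    Function.support (a i) ⊆ I
  hasSum : ∀ w, HasSum (fun i => a i w) (α w)
  summable : ∑' i, supNorm (a i) < ∞

/-- The coefficient map `α` defines an element `φ_α` of `ℓ¹_Ind`. -/
def MemL1Ind (α : FreeGroup ι → ℝ) : Prop := ∃ a, IsIndDecomposition α a

/-- `SInd_α`, the infimum of `∑ᵢ ‖aᵢ‖_∞` over all decompositions of `α`. -/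
noncomputable def SInd (α : FreeGroup ι → ℝ) : ℝ≥0∞ :=
  ⨅ (a : ℕ → FreeGroup ι → ℝ) (_ : IsIndDecomposition α a), ∑' i, supNorm (a i)

/-! ### Rolli quasimorphisms -/

/-- The exponent `±1` of a letter. -/
def letterExp (b : Bool) : ℤ := if b then 1 else -1

/-- Grouping the letters of a word into powers of generators: `(i, m)` stands for `sᵢᵐ`. -/
def syllables : List (ι × Bool) → List (ι × ℤ)
  | [] => []
  | (i, b) :: t =>
    match syllables t with
    | [] => [(i, letterExp b)]
    | (j, m) :: s =>
      if i = j then (j, letterExp b + m) :: s else (i, letterExp b) :: (j, m) :: s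

/-- `φ_l (s_{i₁}^{m₁} ⋯ s_{i_k}^{m_k}) = ∑ l_{i_j}(m_j)`, where `i_j ≠ i_{j+1}` and `m_j ≠ 0`. -/
def rolli (l : ι → ℤ → ℝ) (g : FreeGroup ι) : ℝ :=
  ((syllables g.toWord).map fun p => l p.1 p.2).sum

end Words

/-! ## Quasicocycles with values in functionals -/

section Quasicocycle

/-! The mechanism is to lift the quasimorphism `φ` on the left to a quasicocycle `Φ`: each `Φ g` is
a finite combination of point evaluations on the free group with total mass `φ g`, and `Φ` is a
cocycle for right translation up to an error of norm at most `K`. With `ω(g, h) = Φ(g)(δ¹ψ(·, h))`,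
both `φ ⌣ δ¹ψ` and `δ²ω` may be unbounded. By the cocycle identity for `δ¹ψ`, however, their sum is
exactly the cocycle error of `Φ` tested on `δ¹ψ(·, h)`, so it is bounded by `K * defect ψ`. Its
coboundary is `δ¹φ ⌣ δ¹ψ`. This works for every quasimorphism `ψ`; the Brooks sum enters only
through `defect ψ ≤ weightedSum β` (`defect_bigBrooksSum_le`).

To build `Φ`, attach to each subword of `g` its coefficient, spread evenly over the two suffixes of
`g` that start at its ends. The even spreading makes inversion change the sign exactly, and the
suffixes make a reduced product translate the left factor. By tripods (`isQuasicocycle_of_reduced`)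
only the error at the cut of a reduced product has to be bounded. For an independent family at most
one word of the family straddles a cut (`enorm_wordForm_mul_sub_le`); for Rolli quasimorphisms at
most one syllable is broken (`rolliForm_isQuasicocycle`). -/

theorem enorm_le_supNorm {X : Type*} (f : X → ℝ) (x : X) : ‖f x‖ₑ ≤ supNorm f :=
  le_iSup (fun x => ‖f x‖ₑ) x

theorem supNorm_comp_le {X Y : Type*} (f : X → ℝ) (e : Y → X) :
    supNorm (fun y => f (e y)) ≤ supNorm f :=
  iSup_le fun y => enorm_le_supNorm f (e y)

theorem mem_boundedCochains_of_supNorm {G : Type*} [Group G] {n : ℕ} {f : Cochain G n}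
    (h : supNorm f < ∞) : f ∈ boundedCochains G n := by
  refine ⟨(supNorm f).toReal, fun x => ?_⟩
  simpa using ENNReal.toReal_mono h.ne (enorm_le_supNorm f x)

theorem linearMap_apply_const {X : Type*} (L : (X → ℝ) →ₗ[ℝ] ℝ) (c : ℝ) :
    L (fun _ => c) = L (fun _ => 1) * c := by
  have : (fun _ : X => c) = c • (fun _ : X => (1 : ℝ)) := by
    funext x
    simp
  rw [this, map_smul, smul_eq_mul, mul_comm]

variable {G : Type*} [Group G]

/-- A map to the functionals on `ℝ^G` that is a cocycle, for the action of `G` by right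
translations, up to an error of norm at most `K`. -/
def IsQuasicocycle (Φ : G → (G → ℝ) →ₗ[ℝ] ℝ) (K : ℝ≥0∞) : Prop :=
  ∀ g h u, ‖Φ g (fun x => u (x * h)) + Φ h u - Φ (g * h) u‖ₑ ≤ K * supNorm u

/-- The quasimorphism obtained from a quasicocycle by evaluation at the constant function `1`. -/
def totalMass (Φ : G → (G → ℝ) →ₗ[ℝ] ℝ) (g : G) : ℝ := Φ g (fun _ => 1)

theorem IsQuasicocycle.defect_totalMass_le {Φ : G → (G → ℝ) →ₗ[ℝ] ℝ} {K : ℝ≥0∞}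
    (h : IsQuasicocycle Φ K) : defect (totalMass Φ) ≤ K := by
  refine iSup₂_le fun g g' => ?_
  refine (h g g' fun _ => 1).trans ?_
  simp [supNorm]

theorem delta_two_apply (u : Cochain G 2) (x : Fin 3 → G) :
    delta 2 u x = u ![x 1, x 2] - u ![x 0 * x 1, x 2] + u ![x 0, x 1 * x 2] - u ![x 0, x 1] := by
  have h : delta 2 u x = u (fun i => x i.succ) +
      ((-1) * u (Fin.contractNth 0 (· * ·) x) + u (Fin.contractNth 1 (· * ·) x) +
        (-1) * u (Fin.contractNth 2 (· * ·) x)) := by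
    refine congrArg (u (fun i => x i.succ) + ·) ((Fin.sum_univ_three _).trans ?_)
    norm_num
  have e0 : (fun i : Fin 2 => x i.succ) = ![x 1, x 2] := by
    funext i; fin_cases i <;> rfl
  have e1 : Fin.contractNth 0 (· * ·) x = ![x 0 * x 1, x 2] := by
    funext i; fin_cases i <;> rfl
  have e2 : Fin.contractNth 1 (· * ·) x = ![x 0, x 1 * x 2] := by
    funext i; fin_cases i <;> rfl
  have e3 : Fin.contractNth 2 (· * ·) x = ![x 0, x 1] := by
    funext i; fin_cases i <;> rfl
  rw [h, e0, e1, e2, e3]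
  ring

theorem delta_three_apply (u : Cochain G 3) (x : Fin 4 → G) :
    delta 3 u x = u ![x 1, x 2, x 3] - u ![x 0 * x 1, x 2, x 3] + u ![x 0, x 1 * x 2, x 3] -
      u ![x 0, x 1, x 2 * x 3] + u ![x 0, x 1, x 2] := by
  have h : delta 3 u x = u (fun i => x i.succ) +
      ((-1) * u (Fin.contractNth 0 (· * ·) x) + u (Fin.contractNth 1 (· * ·) x) +
        (-1) * u (Fin.contractNth 2 (· * ·) x) + u (Fin.contractNth 3 (· * ·) x)) := by
    refine congrArg (u (fun i => x i.succ) + ·) ((Fin.sum_univ_four _).trans ?_)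
    norm_num [pow_succ]
  have e0 : (fun i : Fin 3 => x i.succ) = ![x 1, x 2, x 3] := by
    funext i; fin_cases i <;> rfl
  have e1 : Fin.contractNth 0 (· * ·) x = ![x 0 * x 1, x 2, x 3] := by
    funext i; fin_cases i <;> rfl
  have e2 : Fin.contractNth 1 (· * ·) x = ![x 0, x 1 * x 2, x 3] := by
    funext i; fin_cases i <;> rfl
  have e3 : Fin.contractNth 2 (· * ·) x = ![x 0, x 1, x 2 * x 3] := by
    funext i; fin_cases i <;> rfl
  have e4 : Fin.contractNth 3 (· * ·) x = ![x 0, x 1, x 2] := by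
    funext i; fin_cases i <;> rfl
  rw [h, e0, e1, e2, e3, e4]
  ring

/-- A primitive of the cup product `δ¹φ ⌣ δ¹ψ`, where `φ` is the total mass of `Φ`: it is
`φ ⌣ δ¹ψ + δ²ω` for `ω(g, h) = Φ(g)(δ¹ψ(·, h))`. -/
noncomputable def cupPrimitive (Φ : G → (G → ℝ) →ₗ[ℝ] ℝ) (ψ : G → ℝ) : Cochain G 3 := fun x =>
  Φ (x 0) (fun z => deltaOne ψ ![z * x 1, x 2]) + Φ (x 1) (fun z => deltaOne ψ ![z, x 2]) -
    Φ (x 0 * x 1) (fun z => deltaOne ψ ![z, x 2])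

/-- The cocycle identity for `δ¹ψ` at `(z, x 1, x 2)` writes a constant as three functions of `z`;
applying `Φ (x 0)` turns the product with the total mass into three values of the functional. -/
theorem cupPrimitive_eq (Φ : G → (G → ℝ) →ₗ[ℝ] ℝ) (ψ : G → ℝ) (x : Fin 3 → G) :
    cupPrimitive Φ ψ x = totalMass Φ (x 0) * deltaOne ψ ![x 1, x 2] +
      delta 2 (fun y => Φ (y 0) (fun z => deltaOne ψ ![z, y 1])) x := by
  rw [delta_two_apply, totalMass, ← linearMap_apply_const, cupPrimitive]
  have h : (fun _ : G => deltaOne ψ ![x 1, x 2]) = (fun z => deltaOne ψ ![z * x 1, x 2]) -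
      (fun z => deltaOne ψ ![z, x 1 * x 2]) + (fun z => deltaOne ψ ![z, x 1]) := by
    funext z
    simp only [deltaOne_apply, Pi.add_apply, Pi.sub_apply, Matrix.cons_val_zero,
      Matrix.cons_val_one, mul_assoc]
    ring
  rw [h, map_add, map_sub]
  simp only [Matrix.cons_val_zero, Matrix.cons_val_one]
  ring

/-- The summand `δ²ω` is killed by `δ³`, and `δ¹ψ` is a cocycle, so only `δ¹φ ⌣ δ¹ψ` remains of the
Leibniz rule. -/
theorem delta_cupPrimitive (Φ : G → (G → ℝ) →ₗ[ℝ] ℝ) (ψ : G → ℝ) :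
    delta 3 (cupPrimitive Φ ψ) = cupCochain (deltaOne (totalMass Φ)) (deltaOne ψ) := by
  funext x
  have hr : cupCochain (deltaOne (totalMass Φ)) (deltaOne ψ) x =
      deltaOne (totalMass Φ) ![x 0, x 1] * deltaOne ψ ![x 2, x 3] := by
    unfold cupCochain
    congr 2 <;> · funext i; fin_cases i <;> rfl
  rw [hr, delta_three_apply]
  simp only [cupPrimitive_eq, delta_two_apply, deltaOne_apply, Matrix.cons_val_zero,
    Matrix.cons_val_one, Matrix.cons_val, mul_assoc]
  ring

/-- The primitive is literally the quasicocycle error for `(x 0, x 1)` evaluated at `δ¹ψ(·, x 2)`, a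
function bounded by the defect of `ψ`. -/
theorem IsQuasicocycle.supNorm_cupPrimitive_le {Φ : G → (G → ℝ) →ₗ[ℝ] ℝ} {K : ℝ≥0∞}
    (h : IsQuasicocycle Φ K) (ψ : G → ℝ) : supNorm (cupPrimitive Φ ψ) ≤ K * defect ψ := by
  refine iSup_le fun x => ?_
  refine (h (x 0) (x 1) fun z => deltaOne ψ ![z, x 2]).trans ?_
  gcongr
  refine iSup_le fun z => ?_
  change ‖deltaOne ψ ![z, x 2]‖ₑ ≤ _
  rw [deltaOne_apply]
  exact le_iSup₂ (f := fun g h => ‖ψ g + ψ h - ψ (g * h)‖ₑ) z (x 2)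

/-- The cup product of the class of the total mass of a quasicocycle with the class of any
quasimorphism vanishes, with control on the norm of a primitive. -/
theorem cupProduct_totalMass_eq_zero {Φ : G → (G → ℝ) →ₗ[ℝ] ℝ} {K : ℝ≥0∞}
    (h : IsQuasicocycle Φ K) (hK : K < ∞) {ψ : G → ℝ} (hψ : IsQuasimorphism ψ) :
    ∃ hφ : IsQuasimorphism (totalMass Φ),
      cupProduct (qmClass (totalMass Φ) hφ) (qmClass ψ hψ) = 0 ∧
      ∃ π ∈ boundedCochains G 3,
        delta 3 π = cupCochain (deltaOne (totalMass Φ)) (deltaOne ψ) ∧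
        ∀ K', IsQuasicocycle Φ K' → supNorm π ≤ K' * defect ψ := by
  have hb := h.supNorm_cupPrimitive_le ψ
  have hm : cupPrimitive Φ ψ ∈ boundedCochains G 3 :=
    mem_boundedCochains_of_supNorm (hb.trans_lt (ENNReal.mul_lt_top hK hψ))
  have hd := delta_cupPrimitive Φ ψ
  -- The primitive does not involve `K`, so one and the same primitive obeys the bound for every
  -- admissible `K'`; this later allows an infimum.
  refine ⟨h.defect_totalMass_le.trans_lt hK, ?_, _, hm, hd, fun K' h' => h'.supNorm_cupPrimitive_le ψ⟩
  exact (Submodule.Quotient.mk_eq_zero _).mpr ⟨_, hm, hd⟩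

end Quasicocycle

/-! ## Reduced products and paths of suffixes -/

section ReducedProducts

variable {ι : Type*} [DecidableEq ι]

theorem toWord_mul_of_norm {a b : FreeGroup ι} (h : (a * b).norm = a.norm + b.norm) :
    (a * b).toWord = a.toWord ++ b.toWord := by
  refine (FreeGroup.toWord_mul_sublist a b).eq_of_length ?_
  rw [List.length_append]
  exact h

theorem norm_mul_of_isReduced {a b : FreeGroup ι}
    (h : FreeGroup.IsReduced (a.toWord ++ b.toWord)) : (a * b).norm = a.norm + b.norm := by
  rw [FreeGroup.norm, FreeGroup.toWord_mul, h.reduce_eq, List.length_append]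
  rfl

theorem toWord_mk_of_infix {L : List (ι × Bool)} {g : FreeGroup ι} (h : L <:+: g.toWord) :
    (FreeGroup.mk L).toWord = L := by
  rw [FreeGroup.toWord_mk]
  exact (FreeGroup.isReduced_toWord.infix h).reduce_eq

/-- Every pair `g, h` spans a tripod with reduced sides: `g = ab`, `h = b⁻¹c`, `gh = ac`. -/
theorem exists_tripod (g h : FreeGroup ι) : ∃ a b c : FreeGroup ι, g = a * b ∧ h = b⁻¹ * c ∧
    (a * b).norm = a.norm + b.norm ∧ (b⁻¹ * c).norm = b⁻¹.norm + c.norm ∧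
    (a * c).norm = a.norm + c.norm := by
  by_cases hr : FreeGroup.IsReduced (g.toWord ++ h.toWord)
  · exact ⟨g, 1, h, by simp, by simp, by simp, by simp, norm_mul_of_isReduced hr⟩
  -- Otherwise the last letter of `g` cancels the first letter of `h`. Remove both, recurse, and
  -- append the letter to `b`.
  · obtain ⟨A, x, hA⟩ : ∃ A x, g.toWord = A ++ [x] := by
      rcases List.eq_nil_or_concat g.toWord with h0 | ⟨A, x, h0⟩
      · exact absurd (by simpa [h0] using FreeGroup.isReduced_toWord (x := h)) hr
      · exact ⟨A, x, by simpa using h0⟩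
    obtain ⟨y, B, hB⟩ : ∃ y B, h.toWord = y :: B := by
      rcases hh : h.toWord with _ | ⟨y, B⟩
      · exact absurd (by simpa [hh] using FreeGroup.isReduced_toWord (x := g)) hr
      · exact ⟨y, B, rfl⟩
    have hyx : y = (x.1, !x.2) := by
      by_contra hne
      refine hr ?_
      rw [hA, hB, List.append_assoc, List.singleton_append]
      have h1 : FreeGroup.IsReduced (A ++ [x]) := hA ▸ FreeGroup.isReduced_toWord
      have h2 : FreeGroup.IsReduced ([x] ++ (y :: B)) := by
        rw [List.singleton_append, FreeGroup.isReduced_cons_cons]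
        refine ⟨fun h3 => ?_, hB ▸ FreeGroup.isReduced_toWord⟩
        by_contra h4
        refine hne (Prod.ext h3.symm ?_)
        cases hx : x.2 <;> cases hy : y.2 <;> simp_all
      have h5 := h1.append_overlap h2 (by simp)
      rwa [List.append_assoc] at h5
    have hx2 : FreeGroup.mk [y] = (FreeGroup.mk [x])⁻¹ := by
      rw [FreeGroup.inv_mk, hyx]; rfl
    have hg : g = FreeGroup.mk A * FreeGroup.mk [x] := by
      rw [FreeGroup.mul_mk, ← hA, FreeGroup.mk_toWord]
    have hh : h = (FreeGroup.mk [x])⁻¹ * FreeGroup.mk B := by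
      rw [← hx2, FreeGroup.mul_mk, List.singleton_append, ← hB, FreeGroup.mk_toWord]
    have hgn : g.norm = (FreeGroup.mk A).norm + 1 := by
      rw [FreeGroup.norm, FreeGroup.norm, hA, toWord_mk_of_infix (g := g)]
      · simp
      · rw [hA]; exact (List.prefix_append _ _).isInfix
    have hhn : h.norm = (FreeGroup.mk B).norm + 1 := by
      rw [FreeGroup.norm, FreeGroup.norm, hB, toWord_mk_of_infix (g := h)]
      · simp
      · rw [hB]; exact (List.suffix_cons _ _).isInfix
    obtain ⟨a, b, c, e1, e2, n1, n2, n3⟩ :=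
      exists_tripod (FreeGroup.mk A) (FreeGroup.mk B)
    have hx1 : (FreeGroup.mk [x]).norm ≤ 1 := FreeGroup.norm_mk_le
    have g1 : g = a * (b * FreeGroup.mk [x]) := by rw [hg, e1, mul_assoc]
    have g2 : h = (b * FreeGroup.mk [x])⁻¹ * c := by rw [hh, e2]; group
    -- Since `g` has length `a.norm + b.norm + 1`, the triangle inequality forces the enlarged leg
    -- to have length exactly `b.norm + 1`, so no new cancellation occurs.
    have m1 := FreeGroup.norm_mul_le a (b * FreeGroup.mk [x])
    have m2 := FreeGroup.norm_mul_le b (FreeGroup.mk [x])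
    have m3 := FreeGroup.norm_mul_le (b * FreeGroup.mk [x])⁻¹ c
    rw [← e1] at n1
    rw [← e2] at n2
    rw [← g1] at m1
    rw [← g2] at m3
    rw [FreeGroup.norm_inv_eq] at m3 n2
    refine ⟨a, b * FreeGroup.mk [x], c, g1, g2, ?_, ?_, n3⟩
    · rw [← g1]; omega
    · rw [← g2, FreeGroup.norm_inv_eq]; omega
termination_by g.norm
decreasing_by omega

/-- A family of functionals that is additive up to `K` on reduced products and compatible with
inversion is a quasicocycle. -/
theorem isQuasicocycle_of_reduced {Φ : FreeGroup ι → (FreeGroup ι → ℝ) →ₗ[ℝ] ℝ} {K : ℝ≥0∞}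
    (hcut : ∀ a b u, (a * b).norm = a.norm + b.norm →
      ‖Φ (a * b) u - (Φ a (fun x => u (x * b)) + Φ b u)‖ₑ ≤ K * supNorm u)
    (hinv : ∀ b u, Φ b⁻¹ u = - Φ b (fun x => u (x * b⁻¹))) : IsQuasicocycle Φ (3 * K) := by
  intro g h u
  obtain ⟨a, b, c, rfl, rfl, n1, n2, n3⟩ := exists_tripod g h
  set v : FreeGroup ι → ℝ := fun x => u (x * (b⁻¹ * c)) with hv
  have e1 := hcut a b v n1
  have e2 := hcut b⁻¹ c u n2
  have e3 := hcut a c u n3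
  have e4 := hinv b (fun x => u (x * c))
  have hv' : supNorm v ≤ supNorm u := supNorm_comp_le u _
  have f1 : (fun x => v (x * b)) = fun x => u (x * c) := by
    funext x
    simp [hv, mul_assoc]
  have f2 : (fun x => u (x * b⁻¹ * c)) = v := by
    funext x
    simp [hv, mul_assoc]
  rw [f1] at e1
  rw [f2] at e4
  have hac : a * b * (b⁻¹ * c) = a * c := by group
  -- The contributions of the leg `b` and of its inverse cancel by `hinv`, leaving one cut error for
  -- each side of the tripod; hence the factor 3.
  have key : Φ (a * b) v + Φ (b⁻¹ * c) u - Φ (a * b * (b⁻¹ * c)) u =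
      (Φ (a * b) v - (Φ a (fun x => u (x * c)) + Φ b v)) +
      (Φ (b⁻¹ * c) u - (Φ b⁻¹ (fun x => u (x * c)) + Φ c u)) -
      (Φ (a * c) u - (Φ a (fun x => u (x * c)) + Φ c u)) := by
    rw [hac, e4]
    ring
  rw [key]
  calc _ ≤ K * supNorm v + K * supNorm u + K * supNorm u :=
        (enorm_sub_le).trans (add_le_add ((enorm_add_le _ _).trans (add_le_add e1 e2)) e3)
    _ ≤ K * supNorm u + K * supNorm u + K * supNorm u := by gcongr
    _ = 3 * K * supNorm u := by ring

end ReducedProducts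

/-! ## The path form of a coefficient map -/

section PathForm

variable {G : Type*} [Group G]

/-- The functional `u ↦ ∑_{i < j ≤ N} α(sᵢ sⱼ⁻¹) (u(sᵢ) + u(sⱼ)) / 2`. -/
noncomputable def pathForm (α : G → ℝ) (s : ℕ → G) (N : ℕ) : (G → ℝ) →ₗ[ℝ] ℝ :=
  ∑ j ∈ Finset.range (N + 1), ∑ i ∈ Finset.range j,
    (α (s i * (s j)⁻¹) / 2) • (LinearMap.proj (R := ℝ) (φ := fun _ : G => ℝ) (s i) +
      LinearMap.proj (R := ℝ) (φ := fun _ : G => ℝ) (s j))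

theorem pathForm_apply (α : G → ℝ) (s : ℕ → G) (N : ℕ) (u : G → ℝ) :
    pathForm α s N u = ∑ j ∈ Finset.range (N + 1), ∑ i ∈ Finset.range j,
      α (s i * (s j)⁻¹) / 2 * (u (s i) + u (s j)) := by
  simp [pathForm, mul_add]

theorem pathForm_congr (α : G → ℝ) {s t : ℕ → G} {N : ℕ} (h : ∀ i ≤ N, s i = t i) :
    pathForm α s N = pathForm α t N := by
  refine Finset.sum_congr rfl fun j hj => Finset.sum_congr rfl fun i hi => ?_
  rw [Finset.mem_range] at hi hj
  rw [h i (by omega), h j (by omega)]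

theorem pathForm_mul_right (α : G → ℝ) (s : ℕ → G) (N : ℕ) (b : G) (u : G → ℝ) :
    pathForm α (fun i => s i * b) N u = pathForm α s N (fun x => u (x * b)) := by
  simp [pathForm_apply, mul_assoc]

/-- Reversing the path replaces each `s i * (s j)⁻¹` by its inverse and leaves the average of `u` at
the two ends unchanged. This is why the average is used rather than one endpoint. -/
theorem pathForm_reflect {α : G → ℝ} (hα : IsAlternating α) (s : ℕ → G) (N : ℕ) (u : G → ℝ) :
    pathForm α (fun i => s (N - i)) N u = - pathForm α s N u := by
  rw [pathForm_apply, pathForm_apply, Finset.sum_sigma', Finset.sum_sigma',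
    ← Finset.sum_neg_distrib]
  refine Finset.sum_bij' (fun p _ => ⟨N - p.2, N - p.1⟩) (fun p _ => ⟨N - p.2, N - p.1⟩)
    ?_ ?_ ?_ ?_ ?_
  · rintro ⟨j, i⟩ h
    simp only [Finset.mem_sigma, Finset.mem_range] at h ⊢
    omega
  · rintro ⟨j, i⟩ h
    simp only [Finset.mem_sigma, Finset.mem_range] at h ⊢
    omega
  · rintro ⟨j, i⟩ h
    simp only [Finset.mem_sigma, Finset.mem_range] at h
    simp only [Sigma.mk.injEq, heq_eq_eq]
    omega
  · rintro ⟨j, i⟩ h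
    simp only [Finset.mem_sigma, Finset.mem_range] at h
    simp only [Sigma.mk.injEq, heq_eq_eq]
    omega
  · rintro ⟨j, i⟩ h
    dsimp only
    have := hα (s (N - i) * (s (N - j))⁻¹)
    rw [mul_inv_rev, inv_inv] at this
    rw [this]
    ring

/-- Pairs with an end at `p` belong to one of the two halves, so the extra sum runs over pairs
strictly straddling `p`, whence the shift `x.1 + 1`. -/
theorem pathForm_add (α : G → ℝ) (s : ℕ → G) (p q : ℕ) (u : G → ℝ) :
    pathForm α s (p + q) u = pathForm α s p u + pathForm α (fun i => s (p + i)) q u +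
      ∑ x ∈ Finset.range q ×ˢ Finset.range p,
        α (s x.2 * (s (p + (x.1 + 1)))⁻¹) / 2 * (u (s x.2) + u (s (p + (x.1 + 1)))) := by
  rw [pathForm_apply, pathForm_apply, pathForm_apply, Finset.sum_product,
    show p + q + 1 = p + 1 + q by ring, Finset.sum_range_add, Finset.sum_range_succ' _ q,
    Finset.range_zero, Finset.sum_empty, add_zero, add_assoc, ← Finset.sum_add_distrib]
  congr 1
  refine Finset.sum_congr rfl fun k _ => ?_
  rw [show p + 1 + k = p + (k + 1) by ring, Finset.sum_range_add, add_comm]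

theorem hasSum_pathForm {α : G → ℝ} {a : ℕ → G → ℝ} (h : ∀ w, HasSum (fun i => a i w) (α w))
    (s : ℕ → G) (N : ℕ) (u : G → ℝ) :
    HasSum (fun i => pathForm (a i) s N u) (pathForm α s N u) := by
  simp only [pathForm_apply]
  exact hasSum_sum fun j _ => hasSum_sum fun i _ => ((h _).div_const 2).mul_right _

theorem enorm_half_mul_add_le {X : Type*} (c : ℝ) (u : X → ℝ) (x y : X) :
    ‖c / 2 * (u x + u y)‖ₑ ≤ ‖c‖ₑ * supNorm u := by
  rw [div_mul_eq_mul_div, mul_div_assoc, enorm_mul]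
  gcongr
  have h2 : ‖(2 : ℝ)‖ₑ = 2 := by
    rw [Real.enorm_eq_ofReal (by norm_num)]; simp
  rw [div_eq_mul_inv, enorm_mul, enorm_inv (by norm_num), h2, ← div_eq_mul_inv]
  refine ENNReal.div_le_of_le_mul ?_
  rw [mul_two]
  exact (enorm_add_le _ _).trans (add_le_add (enorm_le_supNorm _ _) (enorm_le_supNorm _ _))

theorem enorm_sum_le_of_subsingleton {X : Type*} (s : Finset X) (f : X → ℝ) (B : ℝ≥0∞)
    (h : ∀ x ∈ s, ∀ y ∈ s, f x ≠ 0 → f y ≠ 0 → x = y) (hB : ∀ x, ‖f x‖ₑ ≤ B) :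
    ‖∑ x ∈ s, f x‖ₑ ≤ B := by
  by_cases h0 : ∃ x ∈ s, f x ≠ 0
  · obtain ⟨x, hx, hfx⟩ := h0
    rw [Finset.sum_eq_single_of_mem x hx]
    · exact hB x
    · intro y hy hyx
      by_contra hfy
      exact hyx (h y hy x hx hfy hfx)
  · push Not at h0
    rw [Finset.sum_eq_zero h0]
    simp

end PathForm

/-! ### Suffix paths, independence at a cut, and the quasicocycle of a coefficient map -/

section SuffixPath

variable {ι : Type*} [DecidableEq ι]

/-- The suffix of `g` starting at position `i`. -/
def suffixPath (g : FreeGroup ι) (i : ℕ) : FreeGroup ι := FreeGroup.mk (g.toWord.drop i)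

theorem suffixPath_mul_of_le {a b : FreeGroup ι} (h : (a * b).norm = a.norm + b.norm) {i : ℕ}
    (hi : i ≤ a.norm) : suffixPath (a * b) i = suffixPath a i * b := by
  rw [suffixPath, toWord_mul_of_norm h, List.drop_append_of_le_length hi, ← FreeGroup.mul_mk,
    FreeGroup.mk_toWord, suffixPath]

theorem suffixPath_mul_add {a b : FreeGroup ι} (h : (a * b).norm = a.norm + b.norm) (i : ℕ) :
    suffixPath (a * b) (a.norm + i) = suffixPath b i := by
  rw [suffixPath, toWord_mul_of_norm h, FreeGroup.norm, List.drop_length_add_append, suffixPath]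

/-- A suffix of `b⁻¹` is the inverse of a prefix of `b`, and that prefix is `b` times the inverse of
the complementary suffix. -/
theorem suffixPath_inv (b : FreeGroup ι) (i : ℕ) :
    suffixPath b⁻¹ i = suffixPath b (b.norm - i) * b⁻¹ := by
  have h1 : FreeGroup.mk (b.toWord.take (b.norm - i)) * suffixPath b (b.norm - i) = b := by
    rw [suffixPath, FreeGroup.mul_mk, List.take_append_drop, FreeGroup.mk_toWord]
  have h2 : suffixPath b⁻¹ i = (FreeGroup.mk (b.toWord.take (b.norm - i)))⁻¹ := by
    rw [suffixPath, FreeGroup.toWord_inv, FreeGroup.inv_mk, FreeGroup.invRev, FreeGroup.invRev,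
      List.drop_reverse, List.length_map, List.map_take]
    rfl
  rw [h2, eq_mul_inv_iff_mul_eq, inv_mul_eq_iff_eq_mul, h1]

/-- The word of `g` between the positions `i ≤ j`. -/
theorem toWord_suffixPath_mul_inv (g : FreeGroup ι) {i j : ℕ} (hij : i ≤ j) :
    (suffixPath g i * (suffixPath g j)⁻¹).toWord = (g.toWord.drop i).take (j - i) := by
  have h : suffixPath g i =
      FreeGroup.mk ((g.toWord.drop i).take (j - i)) * suffixPath g j := by
    rw [suffixPath, suffixPath, FreeGroup.mul_mk]
    congr 1
    conv_lhs => rw [← List.take_append_drop (j - i) (g.toWord.drop i)]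
    rw [List.drop_drop, Nat.add_sub_cancel' hij]
  rw [h, mul_inv_cancel_right]
  exact toWord_mk_of_infix ((List.take_prefix _ _).isInfix.trans (List.drop_suffix _ _).isInfix)

theorem norm_suffixPath_mul_inv (g : FreeGroup ι) {i j : ℕ} (hij : i ≤ j) (hj : j ≤ g.norm) :
    (suffixPath g i * (suffixPath g j)⁻¹).norm = j - i := by
  rw [FreeGroup.norm, toWord_suffixPath_mul_inv g hij, List.length_take, List.length_drop]
  change min _ (g.norm - i) = _
  omega

theorem suffixPath_mul_inv_ne_one (g : FreeGroup ι) {i j : ℕ} (hij : i < j) (hj : j ≤ g.norm) :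
    suffixPath g i * (suffixPath g j)⁻¹ ≠ 1 := by
  intro h
  have := norm_suffixPath_mul_inv g hij.le hj
  rw [h, FreeGroup.norm_one] at this
  omega

/-- Two words of an independent family at overlapping positions of `g` agree. -/
theorem IsIndependent.eq_of_mem {I : Set (FreeGroup ι)} (hI : IsIndependent I) (g : FreeGroup ι)
    {i j i' j' p : ℕ} (hi : i < p) (hj : p < j) (hi' : i' < p) (hj' : p < j')
    (hjg : j ≤ g.norm) (hjg' : j' ≤ g.norm)
    (h : suffixPath g i * (suffixPath g j)⁻¹ ∈ I)
    (h' : suffixPath g i' * (suffixPath g j')⁻¹ ∈ I) : i = i' ∧ j = j' := by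
  wlog hle : i ≤ i' generalizing i j i' j'
  · have := this hi' hj' hi hj hjg' hjg h' h (by omega)
    omega
  by_contra hne
  have hn := norm_suffixPath_mul_inv g (i := i) (j := j) (by omega) hjg
  have hn' := norm_suffixPath_mul_inv g (i := i') (j := j') (by omega) hjg'
  refine hI _ h _ h' ?_
  -- Nested intervals or a common start give a proper subword. The remaining order is `i < i' < p <
  -- j < j'`, a proper overlap whose common part is non-empty because both intervals contain `p` in
  -- the interior.
  by_cases hjj : j' ≤ j
  · refine Or.inr ⟨fun e => ?_, Or.inr ⟨suffixPath g i * (suffixPath g i')⁻¹,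
      suffixPath g j' * (suffixPath g j)⁻¹, by group, ?_⟩⟩
    · rw [e] at hn
      omega
    · rw [hn, hn', norm_suffixPath_mul_inv g hle (by omega),
        norm_suffixPath_mul_inv g hjj hjg]
      omega
  · by_cases hii : i = i'
    · subst hii
      refine Or.inr ⟨fun e => ?_, Or.inl ⟨1, suffixPath g j * (suffixPath g j')⁻¹, by group, ?_⟩⟩
      · rw [e] at hn
        omega
      · rw [hn, hn', norm_suffixPath_mul_inv g (by omega) hjg', FreeGroup.norm_one]
        omega
    · refine Or.inl (Or.inl ⟨suffixPath g i * (suffixPath g i')⁻¹,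
        suffixPath g i' * (suffixPath g j)⁻¹, suffixPath g j * (suffixPath g j')⁻¹,
        suffixPath_mul_inv_ne_one g (by omega) (by omega),
        suffixPath_mul_inv_ne_one g (by omega) (by omega),
        suffixPath_mul_inv_ne_one g (by omega) (by omega), by group, ?_, by group, ?_⟩)
      · rw [hn, norm_suffixPath_mul_inv g hle (by omega),
          norm_suffixPath_mul_inv g (by omega) hjg]
        omega
      · rw [hn', norm_suffixPath_mul_inv g (i := i') (by omega) hjg,
          norm_suffixPath_mul_inv g (by omega) hjg']
        omega

/-- The path form of `α` along the suffixes of `g`. -/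
noncomputable def wordForm (α : FreeGroup ι → ℝ) (g : FreeGroup ι) : (FreeGroup ι → ℝ) →ₗ[ℝ] ℝ :=
  pathForm α (suffixPath g) g.norm

theorem wordForm_inv {α : FreeGroup ι → ℝ} (hα : IsAlternating α) (b : FreeGroup ι)
    (u : FreeGroup ι → ℝ) : wordForm α b⁻¹ u = - wordForm α b (fun x => u (x * b⁻¹)) := by
  rw [wordForm, wordForm, FreeGroup.norm_inv_eq, ← pathForm_mul_right, ← pathForm_reflect hα]
  exact congrFun (congrArg _ (pathForm_congr α fun i _ => suffixPath_inv b i)) u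

/-- Only subwords strictly straddling the joint contribute to the difference, and by independence at
most one of them has a non-zero coefficient. -/
theorem enorm_wordForm_mul_sub_le {a : FreeGroup ι → ℝ} {I : Set (FreeGroup ι)}
    (hI : IsIndependent I) (ha : Function.support a ⊆ I) (b c : FreeGroup ι)
    (u : FreeGroup ι → ℝ) (h : (b * c).norm = b.norm + c.norm) :
    ‖wordForm a (b * c) u - (wordForm a b (fun x => u (x * c)) + wordForm a c u)‖ₑ ≤
      supNorm a * supNorm u := by
  have e1 : wordForm a b (fun x => u (x * c)) = pathForm a (suffixPath (b * c)) b.norm u := by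
    rw [wordForm, ← pathForm_mul_right]
    exact congrFun (congrArg _ (pathForm_congr a fun i hi => (suffixPath_mul_of_le h hi).symm)) u
  have e2 : wordForm a c u = pathForm a (fun i => suffixPath (b * c) (b.norm + i)) c.norm u := by
    rw [wordForm]
    exact congrFun (congrArg _ (pathForm_congr a fun i _ => (suffixPath_mul_add h i).symm)) u
  rw [e1, e2, wordForm, h, pathForm_add, add_sub_cancel_left]
  refine enorm_sum_le_of_subsingleton _ _ _ ?_ ?_
  · rintro ⟨k, i⟩ hx ⟨k', i'⟩ hx' h0 h0'
    simp only [Finset.mem_product, Finset.mem_range] at hx hx'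
    have m : ∀ x : FreeGroup ι, ∀ r : ℝ, a x / 2 * r ≠ 0 → x ∈ I := fun x r hr =>
      ha fun h => hr (by rw [h]; simp)
    have := hI.eq_of_mem (b * c) (p := b.norm) (by omega) (by omega) (by omega) (by omega)
      (by omega) (by omega) (m _ _ h0) (m _ _ h0')
    simp only [Prod.mk.injEq]
    omega
  · rintro ⟨k, i⟩
    generalize suffixPath (b * c) (i) = x
    generalize suffixPath (b * c) _ = y
    exact (enorm_half_mul_add_le _ u _ _).trans (mul_le_mul_left (enorm_le_supNorm _ _) _)

theorem IsIndDecomposition.isAlternating {α : FreeGroup ι → ℝ} {a : ℕ → FreeGroup ι → ℝ}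
    (h : IsIndDecomposition α a) : IsAlternating α := fun g => by
  refine (h.hasSum g⁻¹).unique ?_
  simp only [h.alternating _ g]
  exact (h.hasSum g).neg

theorem IsIndDecomposition.support_subset {α : FreeGroup ι → ℝ} {a : ℕ → FreeGroup ι → ℝ}
    (h : IsIndDecomposition α a) : Function.support α ⊆ nonSelfOverlapping ι := fun w hw => by
  by_contra hn
  refine hw ((h.hasSum w).unique ?_)
  have h0 : ∀ i, a i w = 0 := fun i => by
    obtain ⟨I, -, hI, hs⟩ := h.support i
    by_contra hc
    exact hn (hI w (hs hc) w (hs hc))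
  simpa only [h0] using hasSum_zero

/-- `α` itself need not live on an independent set, but the cut error is linear in the coefficients
and involves finitely many of them, so it is the sum of the errors of the pieces. -/
theorem IsIndDecomposition.isQuasicocycle {α : FreeGroup ι → ℝ} {a : ℕ → FreeGroup ι → ℝ}
    (h : IsIndDecomposition α a) :
    IsQuasicocycle (wordForm α) (3 * ∑' i, supNorm (a i)) := by
  refine isQuasicocycle_of_reduced (fun b c u hbc => ?_) (wordForm_inv h.isAlternating)
  have hs := (hasSum_pathForm h.hasSum (suffixPath (b * c)) (b * c).norm u).sub
    ((hasSum_pathForm h.hasSum (suffixPath b) b.norm (fun x => u (x * c))).add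
      (hasSum_pathForm h.hasSum (suffixPath c) c.norm u))
  rw [← ENNReal.tsum_mul_right]
  refine le_of_tendsto_of_tendsto' hs.enorm ENNReal.summable.hasSum fun s => ?_
  refine (enorm_sum_le _ _).trans (Finset.sum_le_sum fun i _ => ?_)
  obtain ⟨I, -, hI, hsup⟩ := h.support i
  exact enorm_wordForm_mul_sub_le hI hsup b c u hbc

end SuffixPath

/-! ## Sums of small Brooks quasimorphisms -/

section SmallBrooks

variable {ι : Type*} [DecidableEq ι]

/-- Two occurrences meeting in more than an endpoint would exhibit a self-overlap of `w`, so all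
occurrences are already disjoint. -/
theorem smallCount_eq_bigCount {w : FreeGroup ι} (hw : w ∈ nonSelfOverlapping ι)
    (g : FreeGroup ι) : smallCount w g = bigCount w g := by
  refine le_antisymm (Finset.sup_le fun T hT => ?_) (Finset.le_sup (f := Finset.card) ?_)
  · exact Finset.card_le_card (Finset.mem_powerset.mp (Finset.mem_filter.mp hT).1)
  · refine Finset.mem_filter.mpr ⟨Finset.mem_powerset_self _, fun i hi j hj hij => ?_⟩
    by_contra hlt
    have hpi := (Finset.mem_filter.mp hi).2
    have hpj := (Finset.mem_filter.mp hj).2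
    have hni := hpi.length_le
    have hnj := hpj.length_le
    rw [List.length_drop] at hni hnj
    change w.norm ≤ g.norm - i at hni
    change w.norm ≤ g.norm - j at hnj
    have key : ∀ k, w.toWord <+: g.toWord.drop k →
        suffixPath g k * (suffixPath g (k + w.norm))⁻¹ = w := fun k hk => by
      refine FreeGroup.toWord_injective ?_
      rw [toWord_suffixPath_mul_inv g (by omega), Nat.add_sub_cancel_left]
      exact (List.prefix_iff_eq_take.mp hk).symm
    have ei := key i hpi
    have ej := key j hpj
    refine hw (Or.inl (Or.inl ⟨suffixPath g i * (suffixPath g j)⁻¹,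
      suffixPath g j * (suffixPath g (i + w.norm))⁻¹,
      suffixPath g (i + w.norm) * (suffixPath g (j + w.norm))⁻¹,
      suffixPath_mul_inv_ne_one g (by omega) (by omega),
      suffixPath_mul_inv_ne_one g (by omega) (by omega),
      suffixPath_mul_inv_ne_one g (by omega) (by omega), ?_, ?_, ?_, ?_⟩))
    · rw [← mul_assoc, inv_mul_cancel_right, ei]
    · rw [norm_suffixPath_mul_inv g (by omega) (by omega),
        norm_suffixPath_mul_inv g (by omega) (by omega)]
      omega
    · rw [← mul_assoc, inv_mul_cancel_right, ej]
    · rw [norm_suffixPath_mul_inv g (by omega) (by omega),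
        norm_suffixPath_mul_inv g (by omega) (by omega)]
      omega

/-- The pairs of positions `i < j` of `g`, as pairs `⟨j, i⟩`. -/
def positionPairs (g : FreeGroup ι) : Finset (Σ _ : ℕ, ℕ) :=
  (Finset.range (g.norm + 1)).sigma fun j => Finset.range j

/-- The non-empty subword of `g` between two positions. -/
def subwordAt (g : FreeGroup ι) (p : Σ _ : ℕ, ℕ) : FreeGroup ι :=
  suffixPath g p.2 * (suffixPath g p.1)⁻¹

theorem bigCount_eq_card {w : FreeGroup ι} (hw : w ≠ 1) (g : FreeGroup ι) :
    bigCount w g = ((positionPairs g).filter fun p => subwordAt g p = w).card := by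
  have hw0 : 0 < w.norm := Nat.pos_of_ne_zero fun h => hw (FreeGroup.norm_eq_zero.mp h)
  refine Finset.card_bij' (fun i _ => ⟨i + w.norm, i⟩) (fun p _ => p.2) ?_ ?_ ?_ ?_
  · intro i hi
    have hp := (Finset.mem_filter.mp hi).2
    have hn := hp.length_le
    rw [List.length_drop] at hn
    change w.norm ≤ g.norm - i at hn
    refine Finset.mem_filter.mpr ⟨?_, ?_⟩
    · simp only [positionPairs, Finset.mem_sigma, Finset.mem_range]
      omega
    · refine FreeGroup.toWord_injective ?_
      rw [subwordAt, toWord_suffixPath_mul_inv g (by simp), Nat.add_sub_cancel_left]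
      exact (List.prefix_iff_eq_take.mp hp).symm
  · rintro ⟨j, i⟩ hp
    simp only [positionPairs, Finset.mem_filter, Finset.mem_sigma, Finset.mem_range] at hp
    refine Finset.mem_filter.mpr ⟨Finset.mem_range.mpr (by dsimp only; omega), ?_⟩
    rw [← hp.2, subwordAt, toWord_suffixPath_mul_inv g hp.1.2.le]
    exact List.take_prefix _ _
  · exact fun _ _ => rfl
  · rintro ⟨j, i⟩ hp
    simp only [positionPairs, Finset.mem_filter, Finset.mem_sigma, Finset.mem_range] at hp
    have := norm_suffixPath_mul_inv g hp.1.2.le (by omega)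
    rw [← hp.2, subwordAt]
    simp only [this, Sigma.mk.injEq, heq_eq_eq, and_true]
    omega

theorem totalMass_wordForm (α : FreeGroup ι → ℝ) (g : FreeGroup ι) :
    totalMass (wordForm α) g = ∑ p ∈ positionPairs g, α (subwordAt g p) := by
  rw [totalMass, wordForm, pathForm_apply, Finset.sum_sigma', positionPairs]
  refine Finset.sum_congr rfl fun p _ => ?_
  rw [subwordAt]
  ring

theorem mul_smallBrooks_eq_sum {α : FreeGroup ι → ℝ} (hα : IsAlternating α)
    (hs : Function.support α ⊆ nonSelfOverlapping ι) (w g : FreeGroup ι) :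
    α w * smallBrooks w g = ∑ p ∈ positionPairs g,
      ((if subwordAt g p = w then α w else 0) - if (subwordAt g p)⁻¹ = w then α w else 0) := by
  by_cases h0 : α w = 0
  · simp [h0]
  · have h1 : w ≠ 1 := by
      rintro rfl
      have := hα 1
      rw [inv_one] at this
      exact h0 (by linarith)
    have h2 : α w⁻¹ ≠ 0 := by
      rw [hα]
      exact neg_ne_zero.mpr h0
    rw [smallBrooks, smallCount_eq_bigCount (hs h0), smallCount_eq_bigCount (hs h2),
      bigCount_eq_card h1, bigCount_eq_card (inv_ne_one.mpr h1), Finset.sum_sub_distrib,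
      ← Finset.sum_filter, ← Finset.sum_filter, Finset.sum_const, Finset.sum_const]
    simp only [nsmul_eq_mul, inv_eq_iff_eq_inv]
    ring

/-- Each subword `v` of `g` with `α v ≠ 0` is counted once: through `w = v` if `v ∈ P`, otherwise
through `w = v⁻¹` with contribution `-α v⁻¹ = α v`. -/
theorem smallBrooksSum_eq_totalMass {α : FreeGroup ι → ℝ} (hα : IsAlternating α)
    (hs : Function.support α ⊆ nonSelfOverlapping ι) {P : Set (FreeGroup ι)}
    (hP : IsPositiveHalf (nonSelfOverlapping ι) P) :
    smallBrooksSum P α = totalMass (wordForm α) := by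
  classical
  funext g
  rw [totalMass_wordForm, smallBrooksSum, finsum_mem_def]
  set W : Finset (FreeGroup ι) := (positionPairs g).image (subwordAt g) ∪
    (positionPairs g).image fun p => (subwordAt g p)⁻¹ with hW
  have e : ∀ w, P.indicator (fun w => α w * smallBrooks w g) w = ∑ p ∈ positionPairs g,
      ((if subwordAt g p = w then P.indicator α w else 0) -
        if (subwordAt g p)⁻¹ = w then P.indicator α w else 0) := by
    intro w
    by_cases hw : w ∈ P
    · simp only [Set.indicator_of_mem hw, mul_smallBrooks_eq_sum hα hs]
    · simp [Set.indicator_of_notMem hw]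
  simp only [e]
  rw [finsum_eq_sum_of_support_subset (s := W), Finset.sum_comm]
  · refine Finset.sum_congr rfl fun p hp => ?_
    have m1 : subwordAt g p ∈ W :=
      Finset.mem_union_left _ (Finset.mem_image_of_mem _ hp)
    have m2 : (subwordAt g p)⁻¹ ∈ W :=
      Finset.mem_union_right _ (Finset.mem_image_of_mem (fun p => (subwordAt g p)⁻¹) hp)
    rw [Finset.sum_sub_distrib, Finset.sum_ite_eq, Finset.sum_ite_eq, if_pos m1, if_pos m2]
    generalize subwordAt g p = v
    by_cases h0 : α v = 0
    · simp [Set.indicator_apply, hα v, h0]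
    · have h1 : v ≠ 1 := by
        rintro rfl
        have := hα 1
        rw [inv_one] at this
        exact h0 (by linarith)
      rcases hP.2 v (hs h0) h1 with ⟨a, b⟩ | ⟨a, b⟩
      · simp [a, b]
      · simp [a, b, hα v]
  · intro w hw
    rw [Function.mem_support] at hw
    by_contra hn
    refine hw (Finset.sum_eq_zero fun p hp => ?_)
    rw [if_neg, if_neg, sub_zero]
    · rintro rfl
      exact hn (Finset.mem_coe.mpr (Finset.mem_union_right _
        (Finset.mem_image_of_mem (fun p => (subwordAt g p)⁻¹) hp)))
    · rintro rfl
      exact hn (Finset.mem_coe.mpr (Finset.mem_union_left _ (Finset.mem_image_of_mem _ hp)))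

end SmallBrooks

/-! ## Rolli quasimorphisms -/

section Rolli

variable {ι : Type*}

/-- The formal inverse of a product of powers of generators. -/
def invSyllables (S : List (ι × ℤ)) : List (ι × ℤ) := (S.map fun p => (p.1, -p.2)).reverse

/-- The element of the free group given by a list of powers of generators. -/
def syllableProd (S : List (ι × ℤ)) : FreeGroup ι :=
  (S.map fun p => FreeGroup.of p.1 ^ p.2).prod

theorem syllableProd_cons (p : ι × ℤ) (S : List (ι × ℤ)) :
    syllableProd (p :: S) = FreeGroup.of p.1 ^ p.2 * syllableProd S := by
  simp [syllableProd]

theorem syllableProd_append (S T : List (ι × ℤ)) :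
    syllableProd (S ++ T) = syllableProd S * syllableProd T := by
  simp [syllableProd]

/-- The path form of `l` along the endpoints of the syllables. -/
noncomputable def syllableForm (l : ι → ℤ → ℝ) :
    List (ι × ℤ) → (FreeGroup ι → ℝ) →ₗ[ℝ] ℝ
  | [] => 0
  | p :: S => (l p.1 p.2 / 2) •
      (LinearMap.proj (R := ℝ) (φ := fun _ : FreeGroup ι => ℝ) (syllableProd (p :: S)) +
        LinearMap.proj (R := ℝ) (φ := fun _ : FreeGroup ι => ℝ) (syllableProd S)) +
      syllableForm l S

theorem syllableForm_cons (l : ι → ℤ → ℝ) (p : ι × ℤ) (S : List (ι × ℤ))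
    (u : FreeGroup ι → ℝ) : syllableForm l (p :: S) u =
      l p.1 p.2 / 2 * (u (syllableProd (p :: S)) + u (syllableProd S)) + syllableForm l S u := by
  rw [syllableForm]
  rfl

theorem syllableForm_append (l : ι → ℤ → ℝ) (S T : List (ι × ℤ)) (u : FreeGroup ι → ℝ) :
    syllableForm l (S ++ T) u =
      syllableForm l S (fun x => u (x * syllableProd T)) + syllableForm l T u := by
  induction S with
  | nil => simp [syllableForm]
  | cons p S ih =>
    rw [List.cons_append, syllableForm_cons, syllableForm_cons, ih, ← List.cons_append,
      syllableProd_append, syllableProd_append]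
    ring

theorem syllableForm_invSyllables {l : ι → ℤ → ℝ} (hl : ∀ i m, l i (-m) = - l i m)
    (S : List (ι × ℤ)) (u : FreeGroup ι → ℝ) : syllableForm l (invSyllables S) u =
      - syllableForm l S (fun x => u (x * (syllableProd S)⁻¹)) := by
  induction S generalizing u with
  | nil => simp [syllableForm, invSyllables]
  | cons p S ih =>
    have h : invSyllables (p :: S) = invSyllables S ++ [(p.1, -p.2)] := by
      simp [invSyllables]
    rw [h, syllableForm_append, ih, syllableForm_cons, syllableForm_cons, hl]
    simp only [syllableProd_cons, mul_inv_rev, mul_assoc]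
    simp [syllableProd, syllableForm]
    ring

/-! ### Syllable decompositions under concatenation and inversion, and the Rolli quasicocycle -/

variable [DecidableEq ι]

/-- Multiply a product of powers of generators by a power from the left. -/
def pushFront (p : ι × ℤ) : List (ι × ℤ) → List (ι × ℤ)
  | [] => [p]
  | q :: s => if p.1 = q.1 then (q.1, p.2 + q.2) :: s else p :: q :: s

/-- Multiply a product of powers of generators by a power from the right. -/
def pushBack (S : List (ι × ℤ)) (p : ι × ℤ) : List (ι × ℤ) := (pushFront p S.reverse).reverse

theorem syllables_cons (x : ι × Bool) (t : List (ι × Bool)) :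
    syllables (x :: t) = pushFront (x.1, letterExp x.2) (syllables t) := by
  obtain ⟨i, b⟩ := x
  rw [syllables]
  cases syllables t <;> rfl

theorem pushFront_append (p : ι × ℤ) {S : List (ι × ℤ)} (hS : S ≠ []) (T : List (ι × ℤ)) :
    pushFront p (S ++ T) = pushFront p S ++ T := by
  cases S with
  | nil => exact absurd rfl hS
  | cons q s =>
    simp only [List.cons_append, pushFront]
    split <;> rfl

/-- The two ends interact only when `S` has at most one syllable. Zero exponents are never deleted,
so no reducedness is needed. This allows syllables, defined from the left, to be read from the
right, as inversion requires. -/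
theorem pushFront_pushBack (p q : ι × ℤ) (S : List (ι × ℤ)) :
    pushFront p (pushBack S q) = pushBack (pushFront p S) q := by
  rcases List.eq_nil_or_concat S with rfl | ⟨S', t, rfl⟩
  · obtain ⟨i, m⟩ := p
    obtain ⟨j, k⟩ := q
    by_cases h : i = j
    · subst h
      simp [pushBack, pushFront, add_comm]
    · simp [pushBack, pushFront, h, Ne.symm h]
  · cases S' with
    | nil =>
      obtain ⟨i, m⟩ := p
      obtain ⟨j, k⟩ := q
      obtain ⟨r, l⟩ := t
      by_cases h : i = r <;> by_cases h' : j = r <;>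
        simp [pushBack, pushFront, h, h', add_left_comm]
    | cons r s =>
      by_cases h : p.1 = r.1 <;> by_cases h' : q.1 = t.1 <;>
        simp [pushBack, pushFront, h, h']

theorem syllables_concat (A : List (ι × Bool)) (x : ι × Bool) :
    syllables (A ++ [x]) = pushBack (syllables A) (x.1, letterExp x.2) := by
  induction A with
  | nil => rw [List.nil_append, syllables_cons]; rfl
  | cons y A ih => rw [List.cons_append, syllables_cons, ih, pushFront_pushBack, syllables_cons]

theorem invSyllables_pushFront (p : ι × ℤ) (S : List (ι × ℤ)) :
    invSyllables (pushFront p S) = pushBack (invSyllables S) (p.1, -p.2) := by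
  cases S with
  | nil => rfl
  | cons q s =>
    by_cases h : p.1 = q.1 <;> simp [invSyllables, pushBack, pushFront, h, add_comm]

theorem syllables_invRev (L : List (ι × Bool)) :
    syllables (FreeGroup.invRev L) = invSyllables (syllables L) := by
  induction L with
  | nil => rfl
  | cons x t ih =>
    have hx : FreeGroup.invRev [x] = [(x.1, !x.2)] := rfl
    have he : letterExp (!x.2) = - letterExp x.2 := by cases x.2 <;> rfl
    rw [FreeGroup.invRev_cons, hx, syllables_concat, ih, syllables_cons, invSyllables_pushFront, he]

/-- Concatenating words concatenates the syllables, except that the two syllables at the joint may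
be merged. -/
theorem syllables_append (A B : List (ι × Bool)) :
    syllables (A ++ B) = syllables A ++ syllables B ∨
      ∃ S i m m' T, syllables A = S ++ [(i, m)] ∧ syllables B = (i, m') :: T ∧
        syllables (A ++ B) = S ++ (i, m + m') :: T := by
  induction A with
  | nil => exact Or.inl rfl
  | cons x A ih =>
    rw [List.cons_append, syllables_cons, syllables_cons]
    -- The new letter can meet `B` only if `A` has no syllables; otherwise it alters the front of
    -- `A`, which is the merged syllable itself when `S` is empty.
    rcases eq_or_ne (syllables A) [] with h0 | h0
    · have hA : syllables (A ++ B) = syllables B := by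
        rcases ih with h | ⟨S, i, m, m', T, h, -⟩
        · rw [h, h0, List.nil_append]
        · simp [h0] at h
      rw [hA, h0]
      rcases syllables B with _ | ⟨⟨j, m'⟩, T⟩
      · exact Or.inl rfl
      · by_cases h : x.1 = j
        · exact Or.inr ⟨[], j, letterExp x.2, m', T, by simp [pushFront, h], rfl,
            by simp [pushFront, h]⟩
        · exact Or.inl (by simp [pushFront, h])
    · rcases ih with h | ⟨S, i, m, m', T, h1, h2, h3⟩
      · exact Or.inl (by rw [h, pushFront_append _ h0])
      · refine Or.inr ?_
        rw [h1, h2, h3]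
        rcases eq_or_ne S [] with rfl | hS
        · by_cases h : x.1 = i
          · exact ⟨[], i, letterExp x.2 + m, m', T, by simp [pushFront, h], rfl,
              by simp [pushFront, h, add_assoc]⟩
          · exact ⟨[(x.1, letterExp x.2)], i, m, m', T, by simp [pushFront, h], rfl,
              by simp [pushFront, h]⟩
        · exact ⟨pushFront (x.1, letterExp x.2) S, i, m, m', T, pushFront_append _ hS _, rfl,
            pushFront_append _ hS _⟩

theorem syllableProd_pushFront (p : ι × ℤ) (S : List (ι × ℤ)) :
    syllableProd (pushFront p S) = FreeGroup.of p.1 ^ p.2 * syllableProd S := by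
  cases S with
  | nil => simp [pushFront, syllableProd]
  | cons q s =>
    by_cases h : p.1 = q.1
    · simp [pushFront, h, syllableProd_cons, zpow_add, mul_assoc]
    · simp [pushFront, h, syllableProd_cons]

theorem syllableProd_syllables (L : List (ι × Bool)) :
    syllableProd (syllables L) = FreeGroup.mk L := by
  induction L with
  | nil => rfl
  | cons x t ih =>
    have hx : FreeGroup.of x.1 ^ letterExp x.2 = FreeGroup.mk [x] := by
      obtain ⟨i, b⟩ := x
      cases b
      · simp [letterExp, FreeGroup.of, FreeGroup.invRev]
      · simp [letterExp, FreeGroup.of]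
    rw [syllables_cons, syllableProd_pushFront, ih, hx, FreeGroup.mul_mk, List.singleton_append]

/-- The functional on the free group whose total mass is the Rolli quasimorphism. -/
noncomputable def rolliForm (l : ι → ℤ → ℝ) (g : FreeGroup ι) : (FreeGroup ι → ℝ) →ₗ[ℝ] ℝ :=
  syllableForm l (syllables g.toWord)

theorem totalMass_rolliForm (l : ι → ℤ → ℝ) : totalMass (rolliForm l) = rolli l := by
  funext g
  rw [totalMass, rolliForm, rolli]
  induction syllables g.toWord with
  | nil => rfl
  | cons p S ih =>
    rw [syllableForm_cons, ih, List.map_cons, List.sum_cons]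
    ring

/-- A cut breaks at most one syllable, `m + m'` into `m` and `m'`: three terms, each at most the
supremum of `l` times that of `u`. The three cuts of a tripod give the other factor 3. -/
theorem rolliForm_isQuasicocycle {l : ι → ℤ → ℝ} (hl : ∀ i m, l i (-m) = - l i m) :
    IsQuasicocycle (rolliForm l) (3 * (3 * ⨆ i, supNorm (l i))) := by
  have hp : ∀ g : FreeGroup ι, syllableProd (syllables g.toWord) = g := fun g => by
    rw [syllableProd_syllables, FreeGroup.mk_toWord]
  refine isQuasicocycle_of_reduced (fun a b u hab => ?_) fun b u => ?_
  · have hb : (fun x => u (x * b)) = fun x => u (x * syllableProd (syllables b.toWord)) := by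
      rw [hp]
    rw [hb, rolliForm, rolliForm, rolliForm, toWord_mul_of_norm hab]
    rcases syllables_append a.toWord b.toWord with h | ⟨S, i, m, m', T, h1, h2, h3⟩
    · rw [h, syllableForm_append, sub_self]
      simp
    · have hterm : ∀ k x y, ‖l i k / 2 * (u x + u y)‖ₑ ≤ (⨆ i, supNorm (l i)) * supNorm u :=
        fun k x y => (enorm_half_mul_add_le _ u x y).trans
          (mul_le_mul_left ((enorm_le_supNorm (l i) k).trans (le_iSup (fun i => supNorm (l i)) i)) _)
      have hprod : syllableProd ((i, m + m') :: T) =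
          syllableProd [(i, m)] * syllableProd ((i, m') :: T) := by
        simp [syllableProd, zpow_add, mul_assoc]
      rw [h1, h2, h3, syllableForm_append, syllableForm_append, syllableForm_cons,
        syllableForm_cons, syllableForm_cons, hprod]
      simp only [syllableForm, LinearMap.zero_apply, add_zero, mul_assoc]
      have key : ∀ A x y z w : ℝ, A + (x + w) - (A + y + (z + w)) = x - y - z :=
        fun A x y z w => by ring
      rw [key]
      calc _ ≤ (⨆ i, supNorm (l i)) * supNorm u + (⨆ i, supNorm (l i)) * supNorm u +
            (⨆ i, supNorm (l i)) * supNorm u :=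
          enorm_sub_le.trans (add_le_add (enorm_sub_le.trans
            (add_le_add (hterm _ _ _) (hterm _ _ _))) (hterm _ _ _))
        _ = _ := by ring
  · rw [rolliForm, rolliForm, FreeGroup.toWord_inv, syllables_invRev,
      syllableForm_invSyllables hl, hp]

end Rolli

/-! ## Sums of big Brooks quasimorphisms and the main theorem -/

section BigBrooks

variable {ι : Type*} [DecidableEq ι]

/-- The empty word is the only one of length below 1, and its Brooks function vanishes because it
equals its own inverse. -/
theorem mul_defect_bigBrooks_le (w : FreeGroup ι) (c : ℝ≥0∞) :
    c * defect (bigBrooks w) ≤ (w.norm : ℝ≥0∞) * c * defect (bigBrooks w) := by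
  rcases eq_or_ne w 1 with rfl | hw
  · have h : defect (bigBrooks (1 : FreeGroup ι)) = 0 := by
      simp [defect, bigBrooks]
    simp [h]
  · have h1 : (1 : ℝ≥0∞) ≤ w.norm := by
      have : w.norm ≠ 0 := fun h => hw (FreeGroup.norm_eq_zero.mp h)
      exact_mod_cast Nat.one_le_iff_ne_zero.mpr this
    rw [mul_assoc]
    exact le_mul_of_one_le_left' h1

theorem defect_bigBrooksSum_le (β : FreeGroup ι → ℝ) :
    defect (bigBrooksSum β) ≤ weightedSum β := by
  refine iSup₂_le fun g h => ?_
  have hf : ∀ x : FreeGroup ι, (Function.support fun w => β w * bigBrooks w x).Finite :=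
    fun x => (finite_bigBrooks_ne_zero x).subset fun w hw => right_ne_zero_of_mul hw
  set W : Finset (FreeGroup ι) :=
    (hf g).toFinset ∪ (hf h).toFinset ∪ (hf (g * h)).toFinset with hW
  have e : ∀ x : FreeGroup ι, (Function.support fun w => β w * bigBrooks w x) ⊆ W →
      bigBrooksSum β x = ∑ w ∈ W, β w * bigBrooks w x := fun x hx =>
    finsum_eq_sum_of_support_subset _ hx
  rw [e g (by intro w; simp +contextual [hW]), e h (by intro w; simp +contextual [hW]),
    e (g * h) (by intro w; simp +contextual [hW]), ← Finset.sum_add_distrib,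
    ← Finset.sum_sub_distrib]
  refine (enorm_sum_le _ _).trans ((Finset.sum_le_sum fun w _ => ?_).trans
    (ENNReal.sum_le_tsum W))
  rw [← mul_add, ← mul_sub, enorm_mul]
  refine le_trans ?_ (mul_defect_bigBrooks_le w ‖β w‖ₑ)
  gcongr
  exact le_iSup₂ (f := fun g h => ‖bigBrooks w g + bigBrooks w h - bigBrooks w (g * h)‖ₑ) g h

theorem le_mul_SInd {α : FreeGroup ι → ℝ} {x c : ℝ≥0∞} (hα : MemL1Ind α) (hc : c ≠ ∞)
    (h : ∀ a, IsIndDecomposition α a → x ≤ c * ∑' i, supNorm (a i)) : x ≤ c * SInd α := by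
  -- A zero constant cannot be divided out of the infimum; there any single decomposition gives `x =
  -- 0`.
  rcases eq_or_ne c 0 with rfl | h0
  · obtain ⟨a, ha⟩ := hα
    simpa using h a ha
  · rw [mul_comm, ← ENNReal.div_le_iff h0 hc]
    refine le_iInf₂ fun a ha => ?_
    rw [ENNReal.div_le_iff h0 hc, mul_comm]
    exact h a ha

end BigBrooks

theorem mainTheorem2 :
    ∃ C : ℝ≥0, ∀ n : ℕ, 2 ≤ n → ∀ β : FreeGroup (Fin n) → ℝ, weightedSum β < ∞ →
      (∀ α : FreeGroup (Fin n) → ℝ, MemL1Ind α →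
        ∀ P : Set (FreeGroup (Fin n)), IsPositiveHalf (nonSelfOverlapping (Fin n)) P →
          ∃ (hφ : IsQuasimorphism (smallBrooksSum P α)) (hψ : IsQuasimorphism (bigBrooksSum β)),
            cupProduct (qmClass (smallBrooksSum P α) hφ) (qmClass (bigBrooksSum β) hψ) = 0 ∧
            ∃ π ∈ boundedCochains (FreeGroup (Fin n)) 3,
              delta 3 π = cupCochain (deltaOne (smallBrooksSum P α)) (deltaOne (bigBrooksSum β)) ∧
              supNorm π ≤ C * (SInd α * weightedSum β)) ∧
      (∀ l : Fin n → ℤ → ℝ, (∀ i m, l i (-m) = - l i m) → (⨆ i, supNorm (l i)) < ∞ →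
          ∃ (hφ : IsQuasimorphism (rolli l)) (hψ : IsQuasimorphism (bigBrooksSum β)),
            cupProduct (qmClass (rolli l) hφ) (qmClass (bigBrooksSum β) hψ) = 0 ∧
            ∃ π ∈ boundedCochains (FreeGroup (Fin n)) 3,
              delta 3 π = cupCochain (deltaOne (rolli l)) (deltaOne (bigBrooksSum β)) ∧
              supNorm π ≤ C * ((⨆ i, supNorm (l i)) * weightedSum β)) := by
  -- The Rolli case needs 9; the first case would need only 3.
  refine ⟨9, fun n _ β hβ => ?_⟩
  have hD := defect_bigBrooksSum_le β
  have hψ : IsQuasimorphism (bigBrooksSum β) := hD.trans_lt hβ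
  refine ⟨fun α hα P hP => ?_, fun l hl hb => ?_⟩
  · obtain ⟨a, ha⟩ := id hα
    rw [smallBrooksSum_eq_totalMass ha.isAlternating ha.support_subset hP]
    obtain ⟨hφ, h0, π, hπ, hd, hn⟩ := cupProduct_totalMass_eq_zero ha.isQuasicocycle
      (ENNReal.mul_lt_top (by simp) ha.summable) hψ
    refine ⟨hφ, hψ, h0, π, hπ, hd, ?_⟩
    rw [mul_comm (SInd α), ← mul_assoc]
    -- `wordForm α` depends on `α` alone, so the fixed `π` satisfies the estimate for every
    -- decomposition.
    refine le_mul_SInd hα (ENNReal.mul_ne_top (by simp) hβ.ne) fun a' ha' => ?_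
    calc supNorm π ≤ 3 * (∑' i, supNorm (a' i)) * defect (bigBrooksSum β) :=
          hn _ ha'.isQuasicocycle
      _ ≤ 9 * (∑' i, supNorm (a' i)) * weightedSum β := by
          gcongr
          norm_num
      _ = _ := by
          push_cast
          ring
  · rw [← totalMass_rolliForm]
    obtain ⟨hφ, h0, π, hπ, hd, hn⟩ := cupProduct_totalMass_eq_zero (rolliForm_isQuasicocycle hl)
      (ENNReal.mul_lt_top (by simp) (ENNReal.mul_lt_top (by simp) hb)) hψ
    refine ⟨hφ, hψ, h0, π, hπ, hd, (hn _ (rolliForm_isQuasicocycle hl)).trans ?_⟩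
    calc _ ≤ 3 * (3 * ⨆ i, supNorm (l i)) * weightedSum β := by gcongr
      _ = _ := by
          push_cast
          ring
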